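/- Let $\mathbb{D}_r=\{z\in\mathbb{C}:|z|<r\}$ and $\mathbb{D}=\mathbb{D}_1$. For a $C^1$ function $f$ write $f_z=\frac12(f_x-if_y)$, $f_{\bar z}=\frac12(f_x+if_y)$, $J_f=|f_z|^2-|f_{\bar z}|^2$ and $D(f)=zf_z-\bar z f_{\bar z}$. Put $$s_0=\frac{\sqrt{17}-1}{\sqrt{17}-3}\sqrt{\frac{2}{5-\sqrt{17}}}\ (\approx 4.1996),\qquad M_0=\frac{\pi}{2\sqrt[4]{2\pi^2-16}},\qquad M_1=\frac{\pi}{\sqrt{\pi^2-8}},$$ and, for $M\ge 1$, $$\lambda_0(M)=\begin{cases}\dfrac{\sqrt2}{\sqrt{M^2-1}+\sqrt{M^2+1}}, & 1\le M\le M_0,\\[2mm] \dfrac{\pi}{4M}, & M>M_0,\end{cases}\qquad T(M)=\begin{cases}\sqrt{2M^2-2}, & 1\le M\le M_1,\\[2mm] \dfrac{4M}{\pi}, & M>M_1.\end{cases}$$ **Theorem.** Let $p\ge1$ be an integer and $M\ge 1$ a real number. The equation $$\lambda_0(M)-\frac{T(M)}{(1-\rho)^2}\sum_{k=2}^p(2k-1)\rho^{2(k-1)}-\sum_{k=1}^p\frac{2T(M)\rho^{2k-1}}{(1-\rho)^3}-\frac{16M}{\pi^2}s_0\arctan\rho=0$$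 has exactly one root $\rho$ in $(0,1)$. Put $$R=\rho\Big[\lambda_0(M)-\sum_{k=2}^p\frac{T(M)\rho^{2(k-1)}}{(1-\rho)^2}-\frac{16M}{\pi^2}s_0\arctan\rho\Big].$$ Then $R>0$ if $M>1$. Moreover, let $G_1,\dots,G_p:\mathbb{D}\to\mathbb{C}$ be harmonic with $|G_{p-k+1}(z)|\le M$ for all $z\in\mathbb{D}$ and $1\le k\le p$, and let $f$ be the $p$-harmonic mapping $$f(z)=\sum_{k=1}^p|z|^{2(k-1)}G_{p-k+1}(z),\qquad z\in\mathbb{D}.$$ If $f(0)=G_p(0)=0$ and $J_f(0)=1$, then $D(f)$ is univalent (injective) in $\mathbb{D}_\rho$, and the image $D(f)(\mathbb{D}_\rho)$ contains the disk $\mathbb{D}_R$ (which is empty when $M=1$, where $R=0$). -/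

import Mathlib

noncomputable section

namespace PHarmonicLandau

/-- The Wirtinger derivative `f_z = (f_x - i f_y) / 2`. -/
def wirtinger (f : ℂ → ℂ) (z : ℂ) : ℂ :=
  (fderiv ℝ f z 1 - Complex.I * fderiv ℝ f z Complex.I) / 2

/-- The conjugate Wirtinger derivative, `(f_x + i f_y) / 2`. -/
def wirtingerBar (f : ℂ → ℂ) (z : ℂ) : ℂ :=
  (fderiv ℝ f z 1 + Complex.I * fderiv ℝ f z Complex.I) / 2

/-- The Jacobian `J_f = |f_z|² - |f_z̄|²`. -/
def jacobian (f : ℂ → ℂ) (z : ℂ) : ℝ :=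
  ‖wirtinger f z‖ ^ 2 - ‖wirtingerBar f z‖ ^ 2

/-- The operator `D(f) = z f_z - z̄ f_z̄`. -/
def opD (f : ℂ → ℂ) (z : ℂ) : ℂ :=
  z * wirtinger f z - (starRingEnd ℂ) z * wirtingerBar f z

/-- `M₀ = π / (2 (2π² - 16)^{1/4})`. -/
def M0 : ℝ := Real.pi / (2 * (2 * Real.pi ^ 2 - 16) ^ ((1 : ℝ) / 4))

/-- `M₁ = π / √(π² - 8)`. -/
def M1 : ℝ := Real.pi / √(Real.pi ^ 2 - 8)

/-- `λ₀(M)`, used for `M ≥ 1`. -/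
def lambda0 (M : ℝ) : ℝ :=
  if M ≤ M0 then √2 / (√(M ^ 2 - 1) + √(M ^ 2 + 1)) else Real.pi / (4 * M)

/-- `T(M)`, used for `M ≥ 1`. -/
def T (M : ℝ) : ℝ :=
  if M ≤ M1 then √(2 * M ^ 2 - 2) else 4 * M / Real.pi

/-- `s₀ = ((√17 - 1) / (√17 - 3)) √(2 / (5 - √17))`. -/
def s0 : ℝ := (√17 - 1) / (√17 - 3) * √(2 / (5 - √17))

/-- The left-hand side of the equation that determines the radius of univalence. -/
def radiusFun (p : ℕ) (M ρ : ℝ) : ℝ :=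
  lambda0 M
    - T M / (1 - ρ) ^ 2 * ∑ k ∈ Finset.Icc 2 p, (2 * (k : ℝ) - 1) * ρ ^ (2 * (k - 1))
    - ∑ k ∈ Finset.Icc 1 p, 2 * T M * ρ ^ (2 * k - 1) / (1 - ρ) ^ 3
    - 16 * M / Real.pi ^ 2 * s0 * Real.arctan ρ

/-- The radius `R` of the covered disk, as a function of `ρ`. -/
def coveredRadius (p : ℕ) (M ρ : ℝ) : ℝ :=
  ρ * (lambda0 M
    - ∑ k ∈ Finset.Icc 2 p, T M * ρ ^ (2 * (k - 1)) / (1 - ρ) ^ 2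
    - 16 * M / Real.pi ^ 2 * s0 * Real.arctan ρ)

end PHarmonicLandau

end

/-!
The operator `opD f` is `-i` times the derivative of `f` in the direction `i z`
(`opD_eq_fderiv`). This direction is tangent to the circles `‖z‖ = const`, so `opD` treats powers
of `‖z‖` as constants and `opD f = ∑ ‖z‖ ^ (2 (k - 1)) opD (G_{p-k+1})` (`opD_pHarmonic`).
A harmonic function on the disk is `∑ aₙ zⁿ + conj (∑ bₙ zⁿ)`, and then
`opD G = ∑ n (aₙ zⁿ - conj (bₙ zⁿ))`. Hence `opD f = L + φ`, where `L z = a₁ z - conj (b₁ z)` comes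
from the coefficients of degree one of `G_p` and `φ` is a sum of monomials of degree at least two.

Fourier analysis on circles gives `|aₙ| + |bₙ| ≤ 4 M / π` (the mean of `|cos|` is `2 / π`) and,
by Parseval, `|a₁|² + |b₁|² + |aₙ|² + |bₙ|² ≤ M²` for `n ≥ 2`. For `G_p`, where `|a₁|² - |b₁|² = 1`,
these yield `‖L z‖ ≥ λ₀(M) ‖z‖` (`lambda0_le_sub`) and `|aₙ| + |bₙ| ≤ T(M)` for `n ≥ 2`
(`add_le_T`). The other `G_k` are not normalized, so only the bound `4 M / π` is available for them.

Since `‖z‖ ^ (2 j) zⁿ` is Lipschitz with constant `(2 j + n) r ^ (2 j + n - 1)` on `‖z‖ ≤ r`, summing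
power series bounds the Lipschitz constant of `φ`. The part `n (n - 1)` of the weight `n²` for `G_p`
is estimated with `T(M)`, everything else with `4 M / π`. The root `ρ` lies below `1 / 5`, because
`λ₀(M) ≤ 1` and `s₀ ≥ 4`; on that range the `arctan` term dominates all contributions estimated
with `4 M / π`, whatever `p` is (`remainder_le_arctanTerm`). Thus on `‖z‖ ≤ r < ρ` the Lipschitz
constant of `φ` is at most `2 T(M) r / (1 - r)³` plus the `arctan` term, which is less than `λ₀(M)`,
so `opD f` is injective. Similarly `‖φ z‖` is at most `r` times the `arctan` term, and the equation
`opD f z = w` is solved by the contraction `z ↦ L⁻¹ (w - φ z)` (`exists_mem_closedBall_eq`).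
-/

noncomputable section
open Complex ComplexConjugate Metric

namespace PHarmonicLandau

/-! ### Wirtinger derivatives and the rotational derivative -/

theorem fderiv_apply_eq_wirtinger (f : ℂ → ℂ) (z v : ℂ) :
    fderiv ℝ f z v = wirtinger f z * v + wirtingerBar f z * conj v := by
  have hv : v = v.re • (1 : ℂ) + v.im • I := by
    simp [Complex.re_add_im]
  have hL : fderiv ℝ f z v = v.re * fderiv ℝ f z 1 + v.im * fderiv ℝ f z I := by
    conv_lhs => rw [hv, map_add, map_smul, map_smul, real_smul, real_smul]
  rw [hL, wirtinger, wirtingerBar]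
  have h₁ := add_conj v
  have h₂ := sub_conj v
  push_cast at h₁ h₂
  linear_combination (-(fderiv ℝ f z 1) / 2) * h₁ + (I * fderiv ℝ f z I / 2) * h₂ + 
    (v.im * fderiv ℝ f z I) * I_sq

theorem opD_eq_fderiv (f : ℂ → ℂ) (z : ℂ) : opD f z = -I * fderiv ℝ f z (I * z) := by
  rw [fderiv_apply_eq_wirtinger, opD, map_mul, conj_I]
  linear_combination (z * wirtinger f z - conj z * wirtingerBar f z) * I_sq

theorem fderiv_add_conj {h g : ℂ → ℂ} {h' g' z : ℂ} (hh : HasDerivAt h h' z)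
    (hg : HasDerivAt g g' z) (v : ℂ) :
    fderiv ℝ (fun w => h w + conj (g w)) z v = h' * v + conj (g' * v) := by
  have h1 := hh.hasFDerivAt.restrictScalars ℝ
  have h2 := hg.hasFDerivAt.restrictScalars ℝ
  have h3 := (conjCLE.toContinuousLinearMap.hasFDerivAt (x := g z)).comp z h2
  have h4 := (h1.add h3).fderiv
  have h5 : (fun w => h w + conj (g w)) = h + (conjCLE.toContinuousLinearMap ∘ g) := by
    ext w; simp
  rw [h5, h4]
  simp [mul_comm]

theorem wirtinger_add_conj {h g : ℂ → ℂ} {h' g' z : ℂ} (hh : HasDerivAt h h' z)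
    (hg : HasDerivAt g g' z) : wirtinger (fun w => h w + conj (g w)) z = h' := by
  rw [wirtinger, fderiv_add_conj hh hg, fderiv_add_conj hh hg, map_mul, map_mul, conj_I, map_one]
  linear_combination (conj g' - h') / 2 * I_sq

theorem wirtingerBar_add_conj {h g : ℂ → ℂ} {h' g' z : ℂ} (hh : HasDerivAt h h' z)
    (hg : HasDerivAt g g' z) : wirtingerBar (fun w => h w + conj (g w)) z = conj g' := by
  rw [wirtingerBar, fderiv_add_conj hh hg, fderiv_add_conj hh hg, map_mul, map_mul, conj_I,
    map_one]
  linear_combination (h' - conj g') / 2 * I_sq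

/-! ### Power series of harmonic functions on the disk -/

/-- A harmonic function on a disk is a holomorphic function plus the conjugate of another one: if its
real and imaginary parts are `Re F₁` and `Re F₂`, take `(F₁ + i F₂) / 2` and `(F₁ - i F₂) / 2`. -/
theorem _root_.InnerProductSpace.HarmonicOnNhd.exists_eqOn_add_conj {G : ℂ → ℂ} {c : ℂ} {R : ℝ}
    (hG : InnerProductSpace.HarmonicOnNhd G (ball c R)) :
    ∃ h g : ℂ → ℂ, DifferentiableOn ℂ h (ball c R) ∧ DifferentiableOn ℂ g (ball c R) ∧
      Set.EqOn G (fun z => h z + conj (g z)) (ball c R) := by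
  obtain ⟨F₁, hF₁, h₁⟩ := (hG.comp_CLM reCLM).exists_analyticOnNhd_ball_re_eq
  obtain ⟨F₂, hF₂, h₂⟩ := (hG.comp_CLM imCLM).exists_analyticOnNhd_ball_re_eq
  have d₁ := hF₁.differentiableOn
  have d₂ := hF₂.differentiableOn
  refine ⟨fun z => (F₁ z + I * F₂ z) / 2, fun z => (F₁ z - I * F₂ z) / 2,
    (d₁.add (d₂.const_mul I)).div_const 2, (d₁.sub (d₂.const_mul I)).div_const 2, ?_⟩
  intro z hz
  have e₁ := h₁ hz
  have e₂ := h₂ hz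
  simp only [Function.comp, reCLM_apply, imCLM_apply] at e₁ e₂
  simp only [map_div₀, map_sub, map_mul, conj_I, Complex.conj_ofNat]
  apply Complex.ext
  · simp [← e₁]; ring
  · simp [← e₂]; ring

theorem exists_hasSum_deriv {h : ℂ → ℂ} (hh : DifferentiableOn ℂ h (ball 0 1)) :
    ∃ a : ℕ → ℂ, (∀ z ∈ ball (0 : ℂ) 1, HasSum (fun n => a n * z ^ n) (h z)) ∧
      (∀ z ∈ ball (0 : ℂ) 1,
        HasSum (fun n : ℕ => ((n : ℂ) + 1) * a (n + 1) * z ^ (n + 1)) (z * deriv h z)) ∧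
      deriv h 0 = a 1 := by
  refine ⟨fun n => (n.factorial : ℂ)⁻¹ * iteratedDeriv n h 0, fun z hz => ?_, fun z hz => ?_, ?_⟩
  · have := hasSum_taylorSeries_on_ball hh hz
    simp only [sub_zero, smul_eq_mul] at this
    convert! this using 2 with n
    ring
  · have := (hasSum_taylorSeries_on_ball (hh.deriv isOpen_ball) hz).mul_left z
    simp only [sub_zero, smul_eq_mul] at this
    convert! this using 2 with n
    beta_reduce
    rw [iteratedDeriv_succ', Nat.factorial_succ, Nat.cast_mul, mul_inv, Nat.cast_succ]
    have : (n : ℂ) + 1 ≠ 0 := Nat.cast_add_one_ne_zero n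
    field_simp
    ring
  · simp [iteratedDeriv_one]

/-- `a` and `b` are the coefficient sequences of the harmonic function
`G = ∑ aₙ zⁿ + conj (∑ bₙ zⁿ)` on the unit disk. The termwise expansion of `opD G`, indexed from
degree one, and the values of the Wirtinger derivatives at the origin are recorded as well. -/
structure IsHarmonicCoeff (G : ℂ → ℂ) (a b : ℕ → ℂ) : Prop where
  summable_left : ∀ z ∈ ball (0 : ℂ) 1, Summable fun n => a n * z ^ n
  summable_right : ∀ z ∈ ball (0 : ℂ) 1, Summable fun n => b n * z ^ n
  eq_tsum : ∀ z ∈ ball (0 : ℂ) 1, G z = ∑' n, a n * z ^ n + conj (∑' n, b n * z ^ n)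
  hasSum_opD : ∀ z ∈ ball (0 : ℂ) 1, HasSum (fun n : ℕ => ((n : ℂ) + 1) *
    (a (n + 1) * z ^ (n + 1) - conj (b (n + 1) * z ^ (n + 1)))) (opD G z)
  wirtinger_zero : wirtinger G 0 = a 1
  wirtingerBar_zero : wirtingerBar G 0 = conj (b 1)

theorem _root_.Filter.EventuallyEq.wirtinger_eq {f g : ℂ → ℂ} {z : ℂ} (h : f =ᶠ[nhds z] g) :
    wirtinger f z = wirtinger g z := by
  rw [wirtinger, wirtinger, h.fderiv_eq]

theorem _root_.Filter.EventuallyEq.wirtingerBar_eq {f g : ℂ → ℂ} {z : ℂ} (h : f =ᶠ[nhds z] g) :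
    wirtingerBar f z = wirtingerBar g z := by
  rw [wirtingerBar, wirtingerBar, h.fderiv_eq]

theorem exists_isHarmonicCoeff {G : ℂ → ℂ}
    (hG : InnerProductSpace.HarmonicOnNhd G (ball (0 : ℂ) 1)) :
    ∃ a b : ℕ → ℂ, IsHarmonicCoeff G a b := by
  obtain ⟨h, g, hh, hg, hGe⟩ := hG.exists_eqOn_add_conj
  obtain ⟨a, ha, ha', ha0⟩ := exists_hasSum_deriv hh
  obtain ⟨b, hb, hb', hb0⟩ := exists_hasSum_deriv hg
  have hev : ∀ z ∈ ball (0 : ℂ) 1, G =ᶠ[nhds z] fun w => h w + conj (g w) := fun z hz =>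
    hGe.eventuallyEq_of_mem (isOpen_ball.mem_nhds hz)
  have hdh : ∀ z ∈ ball (0 : ℂ) 1, HasDerivAt h (deriv h z) z := fun z hz =>
    (hh.differentiableAt (isOpen_ball.mem_nhds hz)).hasDerivAt
  have hdg : ∀ z ∈ ball (0 : ℂ) 1, HasDerivAt g (deriv g z) z := fun z hz =>
    (hg.differentiableAt (isOpen_ball.mem_nhds hz)).hasDerivAt
  have h0 : (0 : ℂ) ∈ ball (0 : ℂ) 1 := by simp
  refine ⟨a, b, fun z hz => (ha z hz).summable, fun z hz => (hb z hz).summable, fun z hz => ?_,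
    fun z hz => ?_, ?_, ?_⟩
  · rw [(ha z hz).tsum_eq, (hb z hz).tsum_eq]
    exact hGe hz
  · rw [opD, (hev z hz).wirtinger_eq, (hev z hz).wirtingerBar_eq,
      wirtinger_add_conj (hdh z hz) (hdg z hz), wirtingerBar_add_conj (hdh z hz) (hdg z hz),
      ← map_mul]
    convert! (ha' z hz).sub (hasSum_conj'.mpr (hb' z hz)) using 2 with n
    simp only [map_mul, map_add, map_pow, map_one, conj_natCast]
    ring
  · rw [(hev 0 h0).wirtinger_eq, wirtinger_add_conj (hdh 0 h0) (hdg 0 h0), ha0]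
  · rw [(hev 0 h0).wirtingerBar_eq, wirtingerBar_add_conj (hdh 0 h0) (hdg 0 h0), hb0]

/-! ### Fourier coefficients of bounded functions and coefficient bounds -/

theorem hasSum_fourierCoeff {ι : Type*} {u : ι → C(UnitAddCircle, ℂ)} {F : C(UnitAddCircle, ℂ)}
    (h : HasSum u F) (k : ℤ) :
    HasSum (fun i => fourierCoeff (u i) k) (fourierCoeff F k) := by
  have key : ∀ f : C(UnitAddCircle, ℂ), fourierCoeff f k =
      (innerSL ℂ (fourierLp 2 k)) (ContinuousMap.toLp 2 AddCircle.haarAddCircle ℂ f) := by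
    intro f
    rw [innerSL_apply_apply, ← fourierCoeff_toLp, ← fourierBasis_repr,
      HilbertBasis.repr_apply_apply, coe_fourierBasis]
  simp only [key]
  exact ((innerSL ℂ (fourierLp 2 k)).comp
    (ContinuousMap.toLp (E := ℂ) 2 AddCircle.haarAddCircle ℂ)).hasSum h

theorem fourierCoeff_smul_fourier (c : ℂ) (m k : ℤ) :
    fourierCoeff ⇑(c • (fourier m : C(UnitAddCircle, ℂ))) k = if k = m then c else 0 := by
  rw [ContinuousMap.coe_smul, fourierCoeff.const_smul, fourierCoeff_fourier, Pi.single_apply]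
  simp

/-- Bessel's inequality for a function on the circle bounded by `M`. -/
theorem sum_norm_sq_fourierCoeff_le {F : C(UnitAddCircle, ℂ)} {M : ℝ} (hF : ∀ t, ‖F t‖ ≤ M)
    (s : Finset ℤ) : ∑ i ∈ s, ‖fourierCoeff F i‖ ^ 2 ≤ M ^ 2 := by
  have h := hasSum_sq_fourierCoeff (ContinuousMap.toLp (E := ℂ) 2 AddCircle.haarAddCircle ℂ F)
  simp only [fourierCoeff_toLp] at h
  refine (sum_le_hasSum s (fun i _ => sq_nonneg _) h).trans ?_
  have hae := ContinuousMap.coeFn_toLp (p := 2) (𝕜 := ℂ) AddCircle.haarAddCircle F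
  rw [MeasureTheory.integral_congr_ae (g := fun t => ‖F t‖ ^ 2)
    (hae.mono fun t ht => by simp only [ht])]
  have hM : ∀ t, ‖F t‖ ^ 2 ≤ M ^ 2 := fun t => by
    have := hF t
    gcongr
  calc ∫ t, ‖F t‖ ^ 2 ∂AddCircle.haarAddCircle
      ≤ ∫ _ : UnitAddCircle, M ^ 2 ∂AddCircle.haarAddCircle := by
        refine MeasureTheory.integral_mono ?_ (MeasureTheory.integrable_const _) hM
        exact (F.continuous.norm.pow 2).integrable_of_hasCompactSupport
          (HasCompactSupport.of_compactSpace _)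
    _ = M ^ 2 := by simp

theorem integral_abs_cos_add_mul {n : ℕ} (hn : n ≠ 0) (d : ℝ) :
    ∫ x in (0 : ℝ)..1, |Real.cos (2 * Real.pi * n * x + d)| = 2 / Real.pi := by
  have hn' : (n : ℝ) ≠ 0 := Nat.cast_ne_zero.mpr hn
  have hper : Function.Periodic (fun x => |Real.cos x|) Real.pi := fun x => by
    simp [Real.cos_add_pi]
  have hpi := Real.pi_pos
  have hperiod : ∀ t : ℝ, ∫ x in t..t + Real.pi, |Real.cos x| = 2 := by
    intro t
    rw [hper.intervalIntegral_add_eq t (-(Real.pi / 2)),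
      show -(Real.pi / 2) + Real.pi = Real.pi / 2 by ring]
    rw [intervalIntegral.integral_congr (g := Real.cos)]
    · rw [integral_cos]
      simp
      norm_num
    · intro x hx
      rw [Set.uIcc_of_le (by linarith)] at hx
      exact abs_of_nonneg (Real.cos_nonneg_of_mem_Icc hx)
  rw [intervalIntegral.integral_comp_mul_add (fun x => |Real.cos x|) (by positivity) d]
  have h := hper.intervalIntegral_add_zsmul_eq (2 * n) d
    (fun t₁ t₂ => (Real.continuous_cos.abs).intervalIntegrable t₁ t₂)
  rw [hperiod] at h
  have e : 2 * Real.pi * n * 1 + d = d + (2 * (n : ℤ)) • Real.pi := by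
    simp only [zsmul_eq_mul]; push_cast; ring
  rw [e, mul_zero, zero_add, h]
  simp only [zsmul_eq_mul, smul_eq_mul]
  push_cast
  field_simp

theorem norm_exp_add_exp (α β : ℝ) :
    ‖exp (α * I) + exp (β * I)‖ = 2 * |Real.cos ((α - β) / 2)| := by
  have : exp (α * I) + exp (β * I) =
      exp (((α + β) / 2 : ℝ) * I) * (2 * (Real.cos ((α - β) / 2) : ℝ)) := by
    rw [ofReal_cos, Complex.two_cos, mul_add, ← Complex.exp_add, ← Complex.exp_add]
    push_cast
    ring_nf
  rw [this, norm_mul, norm_exp_ofReal_mul_I, one_mul, norm_mul, norm_real, Real.norm_eq_abs]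
  simp

/-- A function on the circle bounded by `M` has `|c_n| + |c_{-n}| ≤ 4 M / π`: after rotating both
coefficients to be positive, their sum is the integral of the function against
`2 cos (2 π n x + d)` times a unimodular factor, and `2 / π` is the mean of `|cos|`. -/
theorem norm_fourierCoeff_add_norm_fourierCoeff_neg_le {F : C(UnitAddCircle, ℂ)} {M : ℝ}
    (hF : ∀ t, ‖F t‖ ≤ M) {n : ℕ} (hn : n ≠ 0) :
    ‖fourierCoeff F n‖ + ‖fourierCoeff F (-n)‖ ≤ 4 * M / Real.pi := by
  set c := fourierCoeff F n with hc
  set d := fourierCoeff F (-n) with hd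
  have hM : 0 ≤ M := (norm_nonneg _).trans (hF 0)
  have rot : ∀ w : ℂ, exp ((-arg w : ℝ) * I) * w = ‖w‖ := by
    intro w
    conv_lhs => rw [← norm_mul_exp_arg_mul_I w]
    rw [mul_left_comm, ← Complex.exp_add]
    simp
  have cont : ∀ k : ℤ, Continuous fun x : ℝ => fourier k (x : UnitAddCircle) • F x := by
    intro k
    have := AddCircle.continuous_mk' (1 : ℝ)
    exact ((fourier k).continuous.comp this).smul (F.continuous.comp this)
  have e1 : c = ∫ x in (0 : ℝ)..1, fourier (-n : ℤ) (x : UnitAddCircle) • F x := by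
    rw [hc, fourierCoeff_eq_intervalIntegral _ _ 0]
    simp
  have e2 : d = ∫ x in (0 : ℝ)..1, fourier (n : ℤ) (x : UnitAddCircle) • F x := by
    rw [hd, fourierCoeff_eq_intervalIntegral _ _ 0]
    simp
  have key : ((‖c‖ + ‖d‖ : ℝ) : ℂ) = ∫ x in (0 : ℝ)..1,
      (exp ((-arg c : ℝ) * I) * (fourier (-n : ℤ) (x : UnitAddCircle) • F x) +
        exp ((-arg d : ℝ) * I) * (fourier (n : ℤ) (x : UnitAddCircle) • F x)) := by
    rw [intervalIntegral.integral_add, intervalIntegral.integral_const_mul,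
      intervalIntegral.integral_const_mul, ← e1, ← e2, rot, rot, ofReal_add]
    · exact (continuous_const.mul (cont _)).intervalIntegrable _ _
    · exact (continuous_const.mul (cont _)).intervalIntegrable _ _
  have bound : ∀ x : ℝ, ‖exp ((-arg c : ℝ) * I) * (fourier (-n : ℤ) (x : UnitAddCircle) • F x) +
      exp ((-arg d : ℝ) * I) * (fourier (n : ℤ) (x : UnitAddCircle) • F x)‖ ≤
      2 * M * |Real.cos (2 * Real.pi * n * x + (arg c - arg d) / 2)| := by
    intro x
    have : exp ((-arg c : ℝ) * I) * (fourier (-n : ℤ) (x : UnitAddCircle) • F x) +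
        exp ((-arg d : ℝ) * I) * (fourier (n : ℤ) (x : UnitAddCircle) • F x) =
        (exp ((-arg d + 2 * Real.pi * n * x : ℝ) * I) +
          exp ((-arg c - 2 * Real.pi * n * x : ℝ) * I)) * F x := by
      rw [fourier_coe_apply, fourier_coe_apply]
      simp only [smul_eq_mul, ← mul_assoc, ← Complex.exp_add, add_mul]
      push_cast
      ring_nf
    rw [this, norm_mul, norm_exp_add_exp]
    rw [show (-arg d + 2 * Real.pi * n * x - (-arg c - 2 * Real.pi * n * x)) / 2 =
      2 * Real.pi * n * x + (arg c - arg d) / 2 by ring]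
    have := hF x
    have := abs_nonneg (Real.cos (2 * Real.pi * n * x + (arg c - arg d) / 2))
    nlinarith
  have habs : ‖c‖ + ‖d‖ = ‖((‖c‖ + ‖d‖ : ℝ) : ℂ)‖ := by
    rw [norm_real, Real.norm_of_nonneg (by positivity)]
  rw [habs, key]
  refine (intervalIntegral.norm_integral_le_of_norm_le zero_le_one
    (Filter.Eventually.of_forall fun x _ => bound x)
    (Continuous.intervalIntegrable (by fun_prop) _ _)).trans (le_of_eq ?_)
  rw [intervalIntegral.integral_const_mul, integral_abs_cos_add_mul hn]
  ring

/-- The restriction of `G` to the circle of radius `r` has Fourier coefficients `aₙ rⁿ` at `n` and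
`conj bₙ rⁿ` at `-n`. At `n = 0` the two contributions add up, hence `n ≠ 0`. -/
theorem IsHarmonicCoeff.exists_fourierCoeff_eq {G : ℂ → ℂ} {a b : ℕ → ℂ}
    (hG : IsHarmonicCoeff G a b) {r : ℝ} (hr : r ∈ Set.Ico (0 : ℝ) 1) :
    ∃ F : C(UnitAddCircle, ℂ), (∀ t, ∃ z ∈ ball (0 : ℂ) 1, F t = G z) ∧
      ∀ n : ℕ, n ≠ 0 → fourierCoeff F n = a n * r ^ n ∧
        fourierCoeff F (-n) = conj (b n) * r ^ n := by
  have hrb : (r : ℂ) ∈ ball (0 : ℂ) 1 := by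
    simp [abs_of_nonneg hr.1, hr.2]
  have hball : ∀ t : UnitAddCircle, (r : ℂ) * fourier 1 t ∈ ball (0 : ℂ) 1 := fun t => by
    rw [mem_ball_zero_iff, norm_mul, fourier_apply, Circle.norm_coe, norm_real,
      Real.norm_of_nonneg hr.1, mul_one]
    exact hr.2
  have sa : Summable fun n : ℕ => (a n * r ^ n) • (fourier n : C(UnitAddCircle, ℂ)) := by
    refine Summable.of_norm ?_
    simpa only [norm_smul, fourier_norm, mul_one] using (hG.summable_left r hrb).norm
  have sb : Summable fun n : ℕ =>
      (conj (b n) * r ^ n) • (fourier (-n) : C(UnitAddCircle, ℂ)) := by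
    refine Summable.of_norm ?_
    simpa [norm_smul, fourier_norm] using (hG.summable_right r hrb).norm
  refine ⟨(∑' n : ℕ, (a n * r ^ n) • (fourier n : C(UnitAddCircle, ℂ))) +
      ∑' n : ℕ, (conj (b n) * r ^ n) • (fourier (-n) : C(UnitAddCircle, ℂ)),
    fun t => ⟨r * fourier 1 t, hball t, ?_⟩, fun n hn => ?_⟩
  · have hpow : ∀ n : ℕ, fourier n t = (fourier 1 t) ^ n := by
      intro n
      simp [fourier_apply, AddCircle.toCircle_nsmul]
    rw [hG.eq_tsum _ (hball t), ContinuousMap.add_apply,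
      ← (ContinuousMap.hasSum_apply sa.hasSum t).tsum_eq,
      ← (ContinuousMap.hasSum_apply sb.hasSum t).tsum_eq, conj_tsum]
    congr 1
    · refine tsum_congr fun n => ?_
      rw [ContinuousMap.smul_apply, hpow, mul_pow, smul_eq_mul, mul_assoc]
    · refine tsum_congr fun n => ?_
      rw [ContinuousMap.smul_apply, fourier_neg, hpow]
      simp [mul_pow, mul_assoc]
  · have int : ∀ f : C(UnitAddCircle, ℂ), MeasureTheory.Integrable f AddCircle.haarAddCircle :=
      fun f => f.continuous.integrable_of_hasCompactSupport (HasCompactSupport.of_compactSpace _)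
    have left : ∀ k : ℤ, fourierCoeff
        ⇑(∑' n : ℕ, (a n * r ^ n) • (fourier n : C(UnitAddCircle, ℂ))) k =
        ∑' n : ℕ, if k = n then a n * r ^ n else 0 := fun k => by
      simp only [← (hasSum_fourierCoeff sa.hasSum k).tsum_eq, fourierCoeff_smul_fourier]
    have right : ∀ k : ℤ, fourierCoeff
        ⇑(∑' n : ℕ, (conj (b n) * r ^ n) • (fourier (-n) : C(UnitAddCircle, ℂ))) k =
        ∑' n : ℕ, if k = -n then conj (b n) * r ^ n else 0 := fun k => by
      simp only [← (hasSum_fourierCoeff sb.hasSum k).tsum_eq, fourierCoeff_smul_fourier]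
    rw [ContinuousMap.coe_add, fourierCoeff.add (int _) (int _)]
    simp only [Pi.add_apply, left, right]
    constructor
    · rw [tsum_eq_single n (fun m hm => if_neg (by omega)),
        tsum_eq_single 0 (fun m hm => if_neg (by omega))]
      simp [hn]
    · rw [tsum_eq_single 0 (fun m hm => if_neg (by omega)),
        tsum_eq_single n (fun m hm => if_neg (by omega))]
      simp [hn]

/-- Passage to the limit `r → 1`. -/
theorem le_of_forall_pow_mul_le {x C : ℝ} (n : ℕ)
    (h : ∀ r ∈ Set.Ico (0 : ℝ) 1, r ^ n * x ≤ C) : x ≤ C := by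
  have hc : Filter.Tendsto (fun r : ℝ => r ^ n * x) (nhdsWithin 1 (Set.Iio 1)) (nhds x) := by
    have : ContinuousAt (fun r : ℝ => r ^ n * x) 1 := by fun_prop
    simpa using this.tendsto.mono_left nhdsWithin_le_nhds
  refine le_of_tendsto hc ?_
  filter_upwards [Ico_mem_nhdsLT (zero_lt_one' ℝ)] with r hr using h r hr

theorem IsHarmonicCoeff.norm_add_norm_le {G : ℂ → ℂ} {a b : ℕ → ℂ} {M : ℝ}
    (hG : IsHarmonicCoeff G a b) (hM : ∀ z ∈ ball (0 : ℂ) 1, ‖G z‖ ≤ M) {n : ℕ} (hn : n ≠ 0) :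
    ‖a n‖ + ‖b n‖ ≤ 4 * M / Real.pi := by
  refine le_of_forall_pow_mul_le n fun r hr => ?_
  obtain ⟨F, hF, hc⟩ := hG.exists_fourierCoeff_eq hr
  have h := norm_fourierCoeff_add_norm_fourierCoeff_neg_le (F := F) (M := M)
    (fun t => by obtain ⟨z, hz, e⟩ := hF t; rw [e]; exact hM z hz) hn
  rw [(hc n hn).1, (hc n hn).2] at h
  simp only [norm_mul, norm_pow, norm_real, Real.norm_of_nonneg hr.1, RCLike.norm_conj] at h
  linarith

theorem IsHarmonicCoeff.norm_sq_add_le {G : ℂ → ℂ} {a b : ℕ → ℂ} {M : ℝ}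
    (hG : IsHarmonicCoeff G a b) (hM : ∀ z ∈ ball (0 : ℂ) 1, ‖G z‖ ≤ M) {n : ℕ} (hn : 2 ≤ n) :
    ‖a 1‖ ^ 2 + ‖b 1‖ ^ 2 + (‖a n‖ ^ 2 + ‖b n‖ ^ 2) ≤ M ^ 2 := by
  refine le_of_forall_pow_mul_le (2 * n) fun r hr => ?_
  obtain ⟨F, hF, hc⟩ := hG.exists_fourierCoeff_eq hr
  have h := sum_norm_sq_fourierCoeff_le (F := F) (M := M)
    (fun t => by obtain ⟨z, hz, e⟩ := hF t; rw [e]; exact hM z hz)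
    {((1 : ℕ) : ℤ), -((1 : ℕ) : ℤ), (n : ℤ), -(n : ℤ)}
  rw [Finset.sum_insert (by simp; omega), Finset.sum_insert (by simp; omega),
    Finset.sum_insert (by simp; omega), Finset.sum_singleton,
    (hc 1 one_ne_zero).1, (hc 1 one_ne_zero).2, (hc n (by omega)).1, (hc n (by omega)).2] at h
  simp only [norm_mul, norm_pow, norm_real, Real.norm_of_nonneg hr.1, RCLike.norm_conj, mul_pow,
    ← pow_mul, pow_one] at h
  have hp : r ^ (2 * n) ≤ r ^ 2 := pow_le_pow_of_le_one hr.1 hr.2.le (by omega)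
  have h1 : 0 ≤ ‖a 1‖ ^ 2 + ‖b 1‖ ^ 2 := by positivity
  rw [mul_comm n 2] at h
  nlinarith [mul_le_mul_of_nonneg_right hp h1]

/-! ### The operator `opD` on p-harmonic functions -/

theorem hasFDerivAt_ofReal_norm_pow (j : ℕ) (z : ℂ) :
    HasFDerivAt (fun w : ℂ => ((‖w‖ ^ (2 * j) : ℝ) : ℂ))
      (ofRealCLM.comp ((j * (‖z‖ ^ 2) ^ (j - 1)) • (2 • innerSL ℝ z))) z := by
  have h := (hasStrictFDerivAt_norm_sq z).hasFDerivAt.pow j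
  simp only [pow_mul]
  rw [nsmul_eq_mul] at h
  exact ofRealCLM.hasFDerivAt.comp z h

theorem hasFDerivAt_pHarmonic {p : ℕ} {f : ℂ → ℂ} {G : ℕ → ℂ → ℂ} {z : ℂ}
    (hf : f =ᶠ[nhds z] fun w => ∑ k ∈ Finset.Icc 1 p,
      ((‖w‖ ^ (2 * (k - 1)) : ℝ) : ℂ) * G k w)
    (hG : ∀ k ∈ Finset.Icc 1 p, DifferentiableAt ℝ (G k) z) :
    HasFDerivAt f (∑ k ∈ Finset.Icc 1 p,
      (((‖z‖ ^ (2 * (k - 1)) : ℝ) : ℂ) • fderiv ℝ (G k) z + G k z •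
        (ofRealCLM.comp (((k - 1 : ℕ) * (‖z‖ ^ 2) ^ (k - 1 - 1)) • (2 • innerSL ℝ z))))) z :=
  (HasFDerivAt.fun_sum fun k hk =>
    (hasFDerivAt_ofReal_norm_pow (k - 1) z).mul (hG k hk).hasFDerivAt).congr_of_eventuallyEq hf

/-- `opD` is the derivative in the direction `i z`, which annihilates every function of `‖z‖`. -/
theorem opD_pHarmonic {p : ℕ} {f : ℂ → ℂ} {G : ℕ → ℂ → ℂ} {z : ℂ}
    (hf : f =ᶠ[nhds z] fun w => ∑ k ∈ Finset.Icc 1 p,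
      ((‖w‖ ^ (2 * (k - 1)) : ℝ) : ℂ) * G k w)
    (hG : ∀ k ∈ Finset.Icc 1 p, DifferentiableAt ℝ (G k) z) :
    opD f z = ∑ k ∈ Finset.Icc 1 p, ((‖z‖ ^ (2 * (k - 1)) : ℝ) : ℂ) * opD (G k) z := by
  have hz : inner ℝ z (I * z) = 0 := by
    rw [Complex.inner]
    simp
    ring
  simp only [opD_eq_fderiv, (hasFDerivAt_pHarmonic hf hG).fderiv, sum_apply,
    Finset.mul_sum]
  refine Finset.sum_congr rfl fun k _ => ?_
  simp [hz]
  ring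

/-- The functions `‖z‖ ^ (2 (k - 1))` with `k ≥ 2` vanish at the origin together with their
derivative. -/
theorem fderiv_pHarmonic_zero {p : ℕ} (hp : 1 ≤ p) {f : ℂ → ℂ} {G : ℕ → ℂ → ℂ}
    (hf : f =ᶠ[nhds 0] fun w => ∑ k ∈ Finset.Icc 1 p,
      ((‖w‖ ^ (2 * (k - 1)) : ℝ) : ℂ) * G k w)
    (hG : ∀ k ∈ Finset.Icc 1 p, DifferentiableAt ℝ (G k) 0) :
    fderiv ℝ f 0 = fderiv ℝ (G 1) 0 := by
  rw [(hasFDerivAt_pHarmonic hf hG).fderiv, Finset.sum_eq_single 1]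
  · simp
  · intro k hk hk1
    have : k - 1 ≠ 0 := by
      have := (Finset.mem_Icc.mp hk).1
      omega
    simp [this]
  · intro h
    exact absurd (Finset.mem_Icc.mpr ⟨le_rfl, hp⟩) h

/-! ### Lipschitz and growth estimates from power series -/

theorem norm_pow_sub_pow_le {𝕜 : Type*} [NormedField 𝕜] {x y : 𝕜} {r : ℝ} (hx : ‖x‖ ≤ r)
    (hy : ‖y‖ ≤ r) (n : ℕ) :
    ‖x ^ (n + 1) - y ^ (n + 1)‖ ≤ (n + 1) * r ^ n * ‖x - y‖ := by
  have hr : 0 ≤ r := (norm_nonneg x).trans hx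
  induction n with
  | zero => simp
  | succ n ih =>
    have e : x ^ (n + 1 + 1) - y ^ (n + 1 + 1) =
        (x ^ (n + 1) - y ^ (n + 1)) * x + y ^ (n + 1) * (x - y) := by ring
    calc ‖x ^ (n + 1 + 1) - y ^ (n + 1 + 1)‖
        ≤ ‖x ^ (n + 1) - y ^ (n + 1)‖ * ‖x‖ + ‖y‖ ^ (n + 1) * ‖x - y‖ := by
          rw [e, ← norm_pow, ← norm_mul, ← norm_mul]
          exact norm_add_le _ _
      _ ≤ ((n + 1) * r ^ n * ‖x - y‖) * r + r ^ (n + 1) * ‖x - y‖ := by gcongr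
      _ = (((n + 1 : ℕ) : ℝ) + 1) * r ^ (n + 1) * ‖x - y‖ := by push_cast; ring

theorem norm_ofReal_norm_pow_mul_pow_sub_le {z w : ℂ} {r : ℝ} (hz : ‖z‖ ≤ r) (hw : ‖w‖ ≤ r)
    (j n : ℕ) :
    ‖((‖z‖ ^ (2 * j) : ℝ) : ℂ) * z ^ (n + 1) - ((‖w‖ ^ (2 * j) : ℝ) : ℂ) * w ^ (n + 1)‖ ≤
      r ^ (2 * j) * ((2 * j + 1 + n) * r ^ n) * ‖z - w‖ := by
  have hr : 0 ≤ r := (norm_nonneg z).trans hz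
  have hN : |‖z‖ ^ (2 * j) - ‖w‖ ^ (2 * j)| * r ≤ 2 * j * r ^ (2 * j) * ‖z - w‖ := by
    rcases j with _ | j
    · simp
    · have h := norm_pow_sub_pow_le (x := ‖z‖) (y := ‖w‖) (r := r) (by simpa) (by simpa)
        (2 * j + 1)
      have h' := abs_norm_sub_norm_le z w
      rw [Real.norm_eq_abs, Real.norm_eq_abs] at h
      calc |‖z‖ ^ (2 * (j + 1)) - ‖w‖ ^ (2 * (j + 1))| * r
          ≤ ((((2 * j + 1 : ℕ) : ℝ) + 1) * r ^ (2 * j + 1) * ‖z - w‖) * r := by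
            gcongr
            exact h.trans (by gcongr)
        _ = _ := by push_cast; ring
  have e : ((‖z‖ ^ (2 * j) : ℝ) : ℂ) * z ^ (n + 1) - ((‖w‖ ^ (2 * j) : ℝ) : ℂ) * w ^ (n + 1) =
      ((‖z‖ ^ (2 * j) - ‖w‖ ^ (2 * j) : ℝ) : ℂ) * z ^ (n + 1) +
        ((‖w‖ ^ (2 * j) : ℝ) : ℂ) * (z ^ (n + 1) - w ^ (n + 1)) := by
    push_cast; ring
  have hp := norm_pow_sub_pow_le hz hw n
  calc _ ≤ |‖z‖ ^ (2 * j) - ‖w‖ ^ (2 * j)| * ‖z‖ ^ (n + 1) +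
        ‖w‖ ^ (2 * j) * ‖z ^ (n + 1) - w ^ (n + 1)‖ := by
        rw [e]
        refine (norm_add_le _ _).trans (le_of_eq ?_)
        rw [norm_mul, norm_mul, norm_real, norm_real, norm_pow, Real.norm_eq_abs,
          Real.norm_of_nonneg (by positivity)]
    _ ≤ |‖z‖ ^ (2 * j) - ‖w‖ ^ (2 * j)| * r ^ (n + 1) +
        r ^ (2 * j) * ((n + 1) * r ^ n * ‖z - w‖) := by gcongr
    _ = (|‖z‖ ^ (2 * j) - ‖w‖ ^ (2 * j)| * r) * r ^ n +
        r ^ (2 * j) * ((n + 1) * r ^ n * ‖z - w‖) := by ring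
    _ ≤ (2 * j * r ^ (2 * j) * ‖z - w‖) * r ^ n +
        r ^ (2 * j) * ((n + 1) * r ^ n * ‖z - w‖) := by gcongr
    _ = _ := by ring

theorem hasSum_add_one_mul_pow {r : ℝ} (hr : r ∈ Set.Ico (0 : ℝ) 1) :
    HasSum (fun n : ℕ => ((n : ℝ) + 1) * r ^ n) (1 / (1 - r) ^ 2) := by
  have h := hasSum_choose_mul_geometric_of_norm_lt_one (𝕜 := ℝ) 1 (r := r)
    (by rw [Real.norm_of_nonneg hr.1]; exact hr.2)
  simpa using h

theorem hasSum_add_one_mul_self_mul_pow {r : ℝ} (hr : r ∈ Set.Ico (0 : ℝ) 1) :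
    HasSum (fun n : ℕ => ((n : ℝ) + 1) * n * r ^ n) (2 * r / (1 - r) ^ 3) := by
  have h := (hasSum_choose_mul_geometric_of_norm_lt_one (𝕜 := ℝ) 2 (r := r)
    (by rw [Real.norm_of_nonneg hr.1]; exact hr.2)).mul_left (2 * r)
  rw [← hasSum_nat_add_iff' 1]
  convert! h using 1
  · funext n
    rw [Nat.cast_choose_two]
    push_cast
    ring
  · rw [Finset.sum_range_one]
    push_cast
    ring

/-- Lipschitz estimate for `‖z‖ ^ (2 j) * opD G`: the term of degree `n` of the expansion of `opD G`
contributes at most `n (2 j + n) (|aₙ| + |bₙ|) r ^ (2 j + n - 1)`. -/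
theorem IsHarmonicCoeff.norm_opD_sub_le {G : ℂ → ℂ} {a b : ℕ → ℂ} (hG : IsHarmonicCoeff G a b)
    {c : ℝ} (hc : ∀ n : ℕ, ‖a (n + 1)‖ + ‖b (n + 1)‖ ≤ c) {r : ℝ} (hr : r ∈ Set.Ico (0 : ℝ) 1)
    {z w : ℂ} (hz : ‖z‖ ≤ r) (hw : ‖w‖ ≤ r) (j : ℕ) :
    ‖((‖z‖ ^ (2 * j) : ℝ) : ℂ) * opD G z - ((‖w‖ ^ (2 * j) : ℝ) : ℂ) * opD G w‖ ≤
      c * (r ^ (2 * j) * ((2 * j + 1) / (1 - r) ^ 2 + 2 * r / (1 - r) ^ 3)) * ‖z - w‖ := by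
  have hz1 : z ∈ ball (0 : ℂ) 1 := mem_ball_zero_iff.mpr (hz.trans_lt hr.2)
  have hw1 : w ∈ ball (0 : ℂ) 1 := mem_ball_zero_iff.mpr (hw.trans_lt hr.2)
  have hs := ((hG.hasSum_opD z hz1).mul_left ((‖z‖ ^ (2 * j) : ℝ) : ℂ)).sub
    ((hG.hasSum_opD w hw1).mul_left ((‖w‖ ^ (2 * j) : ℝ) : ℂ))
  have hb := ((((hasSum_add_one_mul_pow hr).mul_left (2 * (j : ℝ) + 1)).add
    (hasSum_add_one_mul_self_mul_pow hr)).mul_left (c * r ^ (2 * j))).mul_right ‖z - w‖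
  refine (hs.norm_le_of_bounded hb fun n => ?_).trans (le_of_eq (by ring))
  set m : ℂ := ((‖z‖ ^ (2 * j) : ℝ) : ℂ) * z ^ (n + 1) -
    ((‖w‖ ^ (2 * j) : ℝ) : ℂ) * w ^ (n + 1) with hm
  have hmb := norm_ofReal_norm_pow_mul_pow_sub_le hz hw j n
  rw [← hm] at hmb
  have e : ((‖z‖ ^ (2 * j) : ℝ) : ℂ) * (((n : ℂ) + 1) *
      (a (n + 1) * z ^ (n + 1) - conj (b (n + 1) * z ^ (n + 1)))) -
      ((‖w‖ ^ (2 * j) : ℝ) : ℂ) * (((n : ℂ) + 1) *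
      (a (n + 1) * w ^ (n + 1) - conj (b (n + 1) * w ^ (n + 1)))) =
      ((n + 1 : ℝ) : ℂ) * (a (n + 1) * m - conj (b (n + 1) * m)) := by
    simp only [hm, map_mul, map_sub, conj_ofReal]
    push_cast
    ring
  rw [e, norm_mul, norm_real, Real.norm_of_nonneg (by positivity)]
  have hr0 := hr.1
  have h0 : 0 ≤ ‖a (n + 1)‖ + ‖b (n + 1)‖ := by positivity
  calc ((n : ℝ) + 1) * ‖a (n + 1) * m - conj (b (n + 1) * m)‖
      ≤ (n + 1) * ((‖a (n + 1)‖ + ‖b (n + 1)‖) * ‖m‖) := by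
        gcongr
        refine (norm_sub_le _ _).trans (le_of_eq ?_)
        rw [RCLike.norm_conj, norm_mul, norm_mul]
        ring
    _ ≤ (n + 1) * (c * (r ^ (2 * j) * ((2 * j + 1 + n) * r ^ n) * ‖z - w‖)) := by
        have := hc n
        gcongr
        exact h0.trans this
    _ = _ := by ring

/-- The real-linear map `z ↦ α z - conj (β z)`; for `α = a₁`, `β = b₁` it is the part of degree one
of the expansion of `opD G` at the origin. -/
def linearPart (α β : ℂ) : ℂ →ₗ[ℝ] ℂ where
  toFun z := α * z - conj (β * z)
  map_add' z w := by simp only [mul_add, map_add]; ring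
  map_smul' x z := by simp only [real_smul, map_mul, conj_ofReal, RingHom.id_apply]; ring

theorem linearPart_apply (α β z : ℂ) : linearPart α β z = α * z - conj (β * z) := rfl

theorem IsHarmonicCoeff.hasSum_opD_sub_linearPart {G : ℂ → ℂ} {a b : ℕ → ℂ}
    (hG : IsHarmonicCoeff G a b) {z : ℂ} (hz : z ∈ ball (0 : ℂ) 1) :
    HasSum (fun n : ℕ => if n = 0 then 0 else ((n : ℂ) + 1) *
      (a (n + 1) * z ^ (n + 1) - conj (b (n + 1) * z ^ (n + 1))))
      (opD G z - linearPart (a 1) (b 1) z) := by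
  convert! (hG.hasSum_opD z hz).sub (hasSum_ite_eq 0 (linearPart (a 1) (b 1) z)) using 2 with n
  split_ifs with h
  · simp [h, linearPart_apply]
  · simp

/-- Lipschitz estimate for the part of `opD G` of degree at least two. The weight `n²` of degree `n` is
split as `n + n (n - 1)`, so that a different coefficient bound can be used for each part. -/
theorem IsHarmonicCoeff.norm_opD_sub_linearPart_sub_le {G : ℂ → ℂ} {a b : ℕ → ℂ}
    (hG : IsHarmonicCoeff G a b) {c t : ℝ} (hc : ∀ n : ℕ, ‖a (n + 2)‖ + ‖b (n + 2)‖ ≤ c)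
    (ht : ∀ n : ℕ, ‖a (n + 2)‖ + ‖b (n + 2)‖ ≤ t) {r : ℝ} (hr : r ∈ Set.Ico (0 : ℝ) 1)
    {z w : ℂ} (hz : ‖z‖ ≤ r) (hw : ‖w‖ ≤ r) :
    ‖(opD G z - linearPart (a 1) (b 1) z) - (opD G w - linearPart (a 1) (b 1) w)‖ ≤
      (c * (1 / (1 - r) ^ 2 - 1) + t * (2 * r / (1 - r) ^ 3)) * ‖z - w‖ := by
  have hz1 : z ∈ ball (0 : ℂ) 1 := mem_ball_zero_iff.mpr (hz.trans_lt hr.2)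
  have hw1 : w ∈ ball (0 : ℂ) 1 := mem_ball_zero_iff.mpr (hw.trans_lt hr.2)
  have hs := (hG.hasSum_opD_sub_linearPart hz1).sub (hG.hasSum_opD_sub_linearPart hw1)
  have hb := (((((hasSum_add_one_mul_pow hr).sub (hasSum_ite_eq 0 (1 : ℝ))).mul_left c).add
    ((hasSum_add_one_mul_self_mul_pow hr).mul_left t))).mul_right ‖z - w‖
  refine hs.norm_le_of_bounded hb fun n => ?_
  rcases n with _ | n
  · simp
  have hmb := norm_pow_sub_pow_le hz hw (n + 1)
  set m : ℂ := z ^ (n + 1 + 1) - w ^ (n + 1 + 1) with hm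
  have e : (((n + 1 : ℕ) : ℂ) + 1) *
      (a (n + 1 + 1) * z ^ (n + 1 + 1) - conj (b (n + 1 + 1) * z ^ (n + 1 + 1))) -
      (((n + 1 : ℕ) : ℂ) + 1) *
      (a (n + 1 + 1) * w ^ (n + 1 + 1) - conj (b (n + 1 + 1) * w ^ (n + 1 + 1))) =
      ((n + 2 : ℝ) : ℂ) * (a (n + 2) * m - conj (b (n + 2) * m)) := by
    simp only [hm, map_mul, map_sub]
    push_cast
    ring
  simp only [Nat.add_eq_zero_iff, one_ne_zero, and_false, if_false]
  rw [e, norm_mul, norm_real, Real.norm_of_nonneg (by positivity)]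
  have hr0 := hr.1
  set q : ℝ := ‖a (n + 2)‖ + ‖b (n + 2)‖ with hq
  have h0 : 0 ≤ q := by positivity
  calc ((n : ℝ) + 2) * ‖a (n + 2) * m - conj (b (n + 2) * m)‖
      ≤ (n + 2) * (q * ‖m‖) := by
        gcongr
        refine (norm_sub_le _ _).trans (le_of_eq ?_)
        rw [RCLike.norm_conj, norm_mul, norm_mul]
        ring
    _ ≤ (n + 2) * (q * ((((n + 1 : ℕ) : ℝ) + 1) * r ^ (n + 1) * ‖z - w‖)) := by gcongr
    _ = (q * ((n + 2) * r ^ (n + 1)) + q * ((n + 2) * (n + 1) * r ^ (n + 1))) * ‖z - w‖ := by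
        push_cast
        ring
    _ ≤ (c * ((n + 2) * r ^ (n + 1)) + t * ((n + 2) * (n + 1) * r ^ (n + 1))) * ‖z - w‖ := by
        have h1 := hc n
        have h2 := ht n
        gcongr
    _ = _ := by push_cast; ring

theorem IsHarmonicCoeff.norm_opD_sub_linearPart_le {G : ℂ → ℂ} {a b : ℕ → ℂ}
    (hG : IsHarmonicCoeff G a b) {c : ℝ} (hc : ∀ n : ℕ, ‖a (n + 2)‖ + ‖b (n + 2)‖ ≤ c)
    {r : ℝ} (hr : r ∈ Set.Ico (0 : ℝ) 1) {z : ℂ} (hz : ‖z‖ ≤ r) :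
    ‖opD G z - linearPart (a 1) (b 1) z‖ ≤ r * (c * (1 / (1 - r) ^ 2 - 1)) := by
  have hz1 : z ∈ ball (0 : ℂ) 1 := mem_ball_zero_iff.mpr (hz.trans_lt hr.2)
  have hb := (((hasSum_add_one_mul_pow hr).sub (hasSum_ite_eq 0 (1 : ℝ))).mul_left c).mul_left r
  refine (hG.hasSum_opD_sub_linearPart hz1).norm_le_of_bounded hb fun n => ?_
  rcases n with _ | n
  · simp
  simp only [Nat.add_eq_zero_iff, one_ne_zero, and_false, if_false]
  have hr0 := hr.1
  rw [norm_mul]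
  calc ‖(((n + 1 : ℕ) : ℂ) + 1)‖ *
        ‖a (n + 1 + 1) * z ^ (n + 1 + 1) - conj (b (n + 1 + 1) * z ^ (n + 1 + 1))‖
      ≤ (n + 2) * ((‖a (n + 2)‖ + ‖b (n + 2)‖) * ‖z‖ ^ (n + 2)) := by
        have e : (((n + 1 : ℕ) : ℂ) + 1) = ((n + 2 : ℕ) : ℂ) := by push_cast; ring
        rw [e, Complex.norm_natCast]
        push_cast
        gcongr
        refine (norm_sub_le _ _).trans (le_of_eq ?_)
        rw [RCLike.norm_conj, norm_mul, norm_mul, norm_pow]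
        ring
    _ ≤ (n + 2) * (c * r ^ (n + 2)) := by
        have h1 := hc n
        have h0 : 0 ≤ c := le_trans (by positivity) h1
        gcongr
    _ = _ := by push_cast; ring

/-! ### Lipschitz perturbations of a linear map of the plane -/

theorem norm_sub_norm_mul_le_norm_linearPart (α β z : ℂ) :
    (‖α‖ - ‖β‖) * ‖z‖ ≤ ‖linearPart α β z‖ := by
  have h := norm_sub_norm_le (α * z) (conj (β * z))
  rw [RCLike.norm_conj, norm_mul, norm_mul] at h
  rw [linearPart_apply]
  linarith

/-- A Lipschitz perturbation of a linear map bounded below: the preimage of `w` is the fixed point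
of the contraction `z ↦ L⁻¹ (w - (F z - L z))`. -/
theorem exists_mem_closedBall_eq {L : ℂ →ₗ[ℝ] ℂ} {F : ℂ → ℂ} {l K m r : ℝ} {w : ℂ} (hr : 0 ≤ r)
    (hL : ∀ z, l * ‖z‖ ≤ ‖L z‖) (hK : 0 ≤ K) (hKl : K < l)
    (hF : ∀ z ∈ closedBall (0 : ℂ) r, ∀ z' ∈ closedBall (0 : ℂ) r,
      ‖(F z - L z) - (F z' - L z')‖ ≤ K * ‖z - z'‖)
    (hm : ∀ z ∈ closedBall (0 : ℂ) r, ‖F z - L z‖ ≤ m) (hw : ‖w‖ + m ≤ l * r) :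
    ∃ z ∈ closedBall (0 : ℂ) r, F z = w := by
  have hl : 0 < l := hK.trans_lt hKl
  have hinj : Function.Injective L := by
    rw [← LinearMap.ker_eq_bot, LinearMap.ker_eq_bot']
    intro z hz
    have h := hL z
    rw [hz, norm_zero] at h
    exact norm_le_zero_iff.mp (nonpos_of_mul_nonpos_right h hl)
  have hsurj := LinearMap.injective_iff_surjective.mp hinj
  choose N hN using hsurj
  set g : ℂ → ℂ := fun z => N (w - (F z - L z)) with hg
  have hLg : ∀ z, L (g z) = w - (F z - L z) := fun z => hN _
  have maps : Set.MapsTo g (closedBall (0 : ℂ) r) (closedBall (0 : ℂ) r) := by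
    intro z hz
    rw [mem_closedBall_zero_iff]
    have h := hL (g z)
    rw [hLg] at h
    have h2 := norm_sub_le w (F z - L z)
    have h3 := hm z hz
    exact le_of_mul_le_mul_left (by linarith) hl
  -- `‖L z‖ ≥ l ‖z‖` makes `L⁻¹` Lipschitz with constant `1 / l`.
  have hcontr : ContractingWith (K / l).toNNReal (maps.restrict g _ _) := by
    refine ⟨?_, LipschitzWith.of_dist_le_mul fun x y => ?_⟩
    · rw [Real.toNNReal_lt_one]
      exact (div_lt_one hl).mpr hKl
    · rw [Subtype.dist_eq, Subtype.dist_eq, dist_eq_norm, dist_eq_norm]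
      rw [Set.MapsTo.val_restrict_apply, Set.MapsTo.val_restrict_apply,
        Real.coe_toNNReal _ (by positivity)]
      have h := hL (g x - g y)
      rw [map_sub, hLg, hLg, sub_sub_sub_cancel_left] at h
      rw [div_mul_eq_mul_div, le_div_iff₀ hl, mul_comm]
      exact h.trans ((hF y y.2 x x.2).trans_eq (by rw [norm_sub_rev (y : ℂ)]))
  obtain ⟨z, hz, hfix, -⟩ := ContractingWith.exists_fixedPoint' isClosed_closedBall.isComplete maps
    hcontr (mem_closedBall_self hr) (edist_ne_top _ _)
  refine ⟨z, hz, ?_⟩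
  have h := hLg z
  rw [hfix.eq] at h
  linear_combination h

/-! ### Bounds for the constants and for the `arctan` term -/

/-- Lower bound for `λ = |a₁| - |b₁| = 1 / (|a₁| + |b₁|)`; each branch of `lambda0` comes from one of
the two upper bounds on `|a₁| + |b₁|`. -/
theorem lambda0_le_sub {M x y : ℝ} (hM : 1 ≤ M) (hx : 0 ≤ x) (hy : 0 ≤ y)
    (hxy : x ^ 2 - y ^ 2 = 1) (h₁ : x + y ≤ 4 * M / Real.pi) (h₂ : x ^ 2 + y ^ 2 ≤ M ^ 2) :
    lambda0 M ≤ x - y := by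
  have hpi := Real.pi_pos
  have hpos : 0 < x - y := by nlinarith
  unfold lambda0
  split_ifs
  · have e2 : √2 ^ 2 = (2 : ℝ) := Real.sq_sqrt (by norm_num)
    have hs : √2 * y ≤ √(M ^ 2 - 1) := by
      apply Real.le_sqrt_of_sq_le
      rw [mul_pow, e2]
      linarith
    have ht : √2 * x ≤ √(M ^ 2 + 1) := by
      apply Real.le_sqrt_of_sq_le
      rw [mul_pow, e2]
      linarith
    have hpos' : 0 < √(M ^ 2 + 1) := Real.sqrt_pos.mpr (by positivity)
    rw [div_le_iff₀ (by positivity)]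
    calc √2 = (x - y) * (√2 * y + √2 * x) := by linear_combination -√2 * hxy
      _ ≤ _ := by gcongr
  · rw [le_div_iff₀ hpi] at h₁
    rw [div_le_iff₀ (by positivity)]
    nlinarith [mul_le_mul_of_nonneg_left h₁ hpos.le]

theorem add_le_T {M u v : ℝ} (h₁ : u + v ≤ 4 * M / Real.pi)
    (h₂ : 1 + (u ^ 2 + v ^ 2) ≤ M ^ 2) : u + v ≤ T M := by
  unfold T
  split_ifs
  · apply Real.le_sqrt_of_sq_le
    nlinarith [sq_nonneg (u - v)]
  · exact h₁

theorem T_nonneg {M : ℝ} (hM : 1 ≤ M) : 0 ≤ T M := by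
  unfold T
  split_ifs
  · positivity
  · have := Real.pi_pos
    positivity

theorem T_pos {M : ℝ} (hM : 1 < M) : 0 < T M := by
  unfold T
  split_ifs
  · exact Real.sqrt_pos.mpr (by nlinarith)
  · have := Real.pi_pos
    positivity

theorem lambda0_pos {M : ℝ} (hM : 1 ≤ M) : 0 < lambda0 M := by
  have := Real.pi_pos
  have h : 0 < √(M ^ 2 + 1) := Real.sqrt_pos.mpr (by positivity)
  unfold lambda0
  split_ifs <;> positivity

theorem lambda0_le_one {M : ℝ} (hM : 1 ≤ M) : lambda0 M ≤ 1 := by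
  unfold lambda0
  split_ifs
  · have h : √2 ≤ √(M ^ 2 + 1) := Real.sqrt_le_sqrt (by nlinarith)
    have h' : 0 < √2 := by positivity
    rw [div_le_one (by positivity)]
    linarith [Real.sqrt_nonneg (M ^ 2 - 1)]
  · rw [div_le_one (by positivity)]
    linarith [Real.pi_le_four]

theorem four_le_s0 : 4 ≤ s0 := by
  have h1 : (4.12 : ℝ) ≤ √17 := Real.le_sqrt_of_sq_le (by norm_num)
  have h2 : √17 ≤ 4.125 := Real.sqrt_le_iff.mpr (by norm_num)
  have h3 : (25 / 9 : ℝ) ≤ (√17 - 1) / (√17 - 3) := by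
    rw [le_div_iff₀ (by linarith)]
    linarith
  have h4 : (3 / 2 : ℝ) ≤ √(2 / (5 - √17)) := by
    apply Real.le_sqrt_of_sq_le
    rw [le_div_iff₀ (by linarith)]
    linarith
  unfold s0
  nlinarith

theorem mul_le_arctan {x : ℝ} (hx : x ∈ Set.Icc (0 : ℝ) (1 / 5)) :
    25 / 26 * x ≤ Real.arctan x := by
  have hd : ∀ y : ℝ, HasDerivAt (fun y => Real.arctan y - 25 / 26 * y)
      (1 / (1 + y ^ 2) - 25 / 26 * 1) y := fun y =>
    (Real.hasDerivAt_arctan y).sub ((hasDerivAt_id y).const_mul _)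
  have hmono : MonotoneOn (fun y => Real.arctan y - 25 / 26 * y) (Set.Icc (0 : ℝ) (1 / 5)) := by
    refine monotoneOn_of_deriv_nonneg (convex_Icc _ _)
      (fun y _ => (hd y).continuousAt.continuousWithinAt)
      (fun y _ => (hd y).differentiableAt.differentiableWithinAt) fun y hy => ?_
    rw [interior_Icc] at hy
    rw [(hd y).deriv, sub_nonneg, le_div_iff₀ (by positivity)]
    nlinarith [hy.1, hy.2]
  have h := hmono (Set.left_mem_Icc.mpr (by norm_num)) hx hx.1
  simp only [Real.arctan_zero] at h
  linarith

/-- The `arctan` term of `radiusFun`. -/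
def arctanTerm (M r : ℝ) : ℝ := 16 * M / Real.pi ^ 2 * s0 * Real.arctan r

/-- A bound for `∑ (4 j + 3) / 25 ^ j`, `j ≥ 1`, with a negative remainder that makes the induction
close. -/
theorem sum_weight_le (p : ℕ) (hp : 1 ≤ p) :
    ∑ k ∈ Finset.Icc 2 p, (4 * ((k - 1 : ℕ) : ℝ) + 3) * (1 / 25) ^ (k - 1) ≤
      1 / 3 - (((p - 1 : ℕ) : ℝ) + 1 / 3) * (1 / 25) ^ (p - 1) := by
  induction p, hp using Nat.le_induction with
  | base => simp
  | succ n hn ih =>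
    rw [Finset.sum_Icc_succ_top (by omega)]
    obtain ⟨m, rfl⟩ := Nat.exists_eq_add_of_le' hn
    simp only [Nat.add_sub_cancel] at ih ⊢
    push_cast
    rw [pow_succ]
    have : (0 : ℝ) < (1 / 25) ^ m := by positivity
    have hm : (0 : ℝ) ≤ m := Nat.cast_nonneg m
    nlinarith [mul_nonneg hm this.le]

/-- For `r ≤ 1 / 5` the `arctan` term dominates, uniformly in the number of summands, every
contribution estimated with the coefficient bound `4 M / π`. -/
theorem remainder_le_arctanTerm {M r : ℝ} (hM : 1 ≤ M) (p : ℕ) (hp : 1 ≤ p)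
    (hr : r ∈ Set.Icc (0 : ℝ) (1 / 5)) :
    4 * M / Real.pi * (1 / (1 - r) ^ 2 - 1) + ∑ k ∈ Finset.Icc 2 p, 4 * M / Real.pi *
      (r ^ (2 * (k - 1)) * ((2 * ((k - 1 : ℕ) : ℝ) + 1) / (1 - r) ^ 2 + 2 * r / (1 - r) ^ 3)) ≤
      arctanTerm M r := by
  obtain ⟨h0, h5⟩ := hr
  have hpi := Real.pi_pos
  have hA : 0 ≤ 4 * M / Real.pi := by positivity
  have hq : (4 / 5 : ℝ) ≤ 1 - r := by linarith
  -- Both sides are compared with multiples of `r`: up to the common factor `4 M / π`, the left side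
  -- is at most `(45 / 16 + 125 / 96) r`, and the right side is at least `9 / 2 r`.
  have e1 : 1 / (1 - r) ^ 2 - 1 ≤ 45 / 16 * r := by
    have : 1 / (1 - r) ^ 2 - 1 = r * (2 - r) / (1 - r) ^ 2 := by
      field_simp
      ring
    rw [this, div_le_iff₀ (by positivity)]
    have : 0 ≤ r * ((1 - 5 * r) * (13 - 9 * r)) :=
      mul_nonneg h0 (mul_nonneg (by linarith) (by linarith))
    nlinarith
  have e2 : ∀ k ∈ Finset.Icc 2 p, r ^ (2 * (k - 1)) *
      ((2 * ((k - 1 : ℕ) : ℝ) + 1) / (1 - r) ^ 2 + 2 * r / (1 - r) ^ 3) ≤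
      125 / 32 * r * ((4 * ((k - 1 : ℕ) : ℝ) + 3) * (1 / 25) ^ (k - 1)) := by
    intro k hk
    obtain ⟨j, hj⟩ : ∃ j, k - 1 = j + 1 := ⟨k - 2, by have := (Finset.mem_Icc.mp hk).1; omega⟩
    rw [hj]
    have f1 : r ^ (2 * (j + 1)) ≤ r * (5 * (1 / 25) ^ (j + 1)) := by
      calc r ^ (2 * (j + 1)) = r * r ^ (2 * j + 1) := by ring
        _ ≤ r * (1 / 5) ^ (2 * j + 1) := by gcongr
        _ = r * (5 * (1 / 25) ^ (j + 1)) := by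
          rw [show (1 / 25 : ℝ) = (1 / 5) ^ 2 by norm_num, ← pow_mul]
          ring
    have f2 : (2 * ((j + 1 : ℕ) : ℝ) + 1) / (1 - r) ^ 2 + 2 * r / (1 - r) ^ 3 ≤
        25 / 32 * (4 * ((j + 1 : ℕ) : ℝ) + 3) := by
      have g1 : (2 * ((j + 1 : ℕ) : ℝ) + 1) / (1 - r) ^ 2 ≤
          (2 * ((j + 1 : ℕ) : ℝ) + 1) / (4 / 5) ^ 2 := by gcongr
      have g2 : 2 * r / (1 - r) ^ 3 ≤ 2 * (1 / 5) / (4 / 5) ^ 3 := by gcongr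
      have g3 : (2 * ((j + 1 : ℕ) : ℝ) + 1) / (4 / 5) ^ 2 + 2 * (1 / 5) / (4 / 5) ^ 3 =
          25 / 32 * (4 * ((j + 1 : ℕ) : ℝ) + 3) := by ring
      linarith
    have hq' : 0 ≤ 1 - r := by linarith
    calc _ ≤ r * (5 * (1 / 25) ^ (j + 1)) * (25 / 32 * (4 * ((j + 1 : ℕ) : ℝ) + 3)) := by
          gcongr
      _ = _ := by ring
  have e3 : ∑ k ∈ Finset.Icc 2 p, r ^ (2 * (k - 1)) *
      ((2 * ((k - 1 : ℕ) : ℝ) + 1) / (1 - r) ^ 2 + 2 * r / (1 - r) ^ 3) ≤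
      125 / 32 * r * (1 / 3) := by
    refine (Finset.sum_le_sum e2).trans ?_
    rw [← Finset.mul_sum]
    have h1 := sum_weight_le p hp
    have h2 : 0 ≤ (((p - 1 : ℕ) : ℝ) + 1 / 3) * (1 / 25) ^ (p - 1) := by positivity
    have h3 : 0 ≤ 125 / 32 * r := by positivity
    exact mul_le_mul_of_nonneg_left (by linarith) h3
  have e4 : 9 / 2 * r ≤ 4 / Real.pi * s0 * Real.arctan r := by
    have h1 := mul_le_arctan ⟨h0, h5⟩
    have h2 := four_le_s0
    have h3 : (6 / 5 : ℝ) ≤ 4 / Real.pi := by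
      rw [le_div_iff₀ hpi]
      linarith [Real.pi_lt_d2]
    calc 9 / 2 * r ≤ 6 / 5 * 4 * (25 / 26 * r) := by linarith
      _ ≤ 4 / Real.pi * s0 * Real.arctan r := by gcongr
  have e5 : arctanTerm M r = 4 * M / Real.pi * (4 / Real.pi * s0 * Real.arctan r) := by
    unfold arctanTerm
    field_simp
    ring
  rw [← Finset.mul_sum, ← mul_add, e5]
  exact mul_le_mul_of_nonneg_left (by linarith) hA

theorem arctanTerm_strictMono {M : ℝ} (hM : 1 ≤ M) : StrictMono (arctanTerm M) := by
  have := four_le_s0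
  have := Real.pi_pos
  exact Real.arctan_strictMono.const_mul (by positivity)

theorem arctanTerm_nonneg {M r : ℝ} (hM : 1 ≤ M) (hr : 0 ≤ r) : 0 ≤ arctanTerm M r := by
  simpa [arctanTerm] using (arctanTerm_strictMono hM).monotone hr

theorem continuous_arctanTerm (M : ℝ) : Continuous (arctanTerm M) :=
  Real.continuous_arctan.const_mul _

/-! ### The radius of univalence and the covered radius -/

theorem radiusFun_eq (p : ℕ) (M r : ℝ) : radiusFun p M r = lambda0 M
    - T M / (1 - r) ^ 2 * ∑ k ∈ Finset.Icc 2 p, (2 * (k : ℝ) - 1) * r ^ (2 * (k - 1))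
    - ∑ k ∈ Finset.Icc 1 p, 2 * T M * r ^ (2 * k - 1) / (1 - r) ^ 3 - arctanTerm M r := rfl

theorem one_le_two_mul_sub_one {p k : ℕ} (hk : k ∈ Finset.Icc 2 p) :
    (1 : ℝ) ≤ 2 * (k : ℝ) - 1 := by
  have : (2 : ℝ) ≤ k := by exact_mod_cast (Finset.mem_Icc.mp hk).1
  linarith

theorem radiusFun_strictAntiOn (p : ℕ) {M : ℝ} (hM : 1 ≤ M) :
    StrictAntiOn (radiusFun p M) (Set.Ico 0 1) := by
  intro r hr s hs hrs
  have hT := T_nonneg hM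
  have hr0 := hr.1
  have hr1 : 0 < 1 - r := by linarith [hr.2]
  have hs1 : 0 < 1 - s := by linarith [hs.2]
  have h1 : T M / (1 - r) ^ 2 * ∑ k ∈ Finset.Icc 2 p, (2 * (k : ℝ) - 1) * r ^ (2 * (k - 1)) ≤
      T M / (1 - s) ^ 2 * ∑ k ∈ Finset.Icc 2 p, (2 * (k : ℝ) - 1) * s ^ (2 * (k - 1)) := by
    have h0 : ∀ k ∈ Finset.Icc 2 p, 0 ≤ (2 * (k : ℝ) - 1) * r ^ (2 * (k - 1)) := fun k hk => by
      have := one_le_two_mul_sub_one hk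
      positivity
    have h0' := Finset.sum_nonneg h0
    gcongr with k hk
    linarith [one_le_two_mul_sub_one hk]
  have h2 : ∑ k ∈ Finset.Icc 1 p, 2 * T M * r ^ (2 * k - 1) / (1 - r) ^ 3 ≤
      ∑ k ∈ Finset.Icc 1 p, 2 * T M * s ^ (2 * k - 1) / (1 - s) ^ 3 := by
    have hs0 := hs.1
    gcongr
  have h3 := arctanTerm_strictMono hM hrs
  rw [radiusFun_eq, radiusFun_eq]
  linarith

theorem radiusFun_continuousOn (p : ℕ) (M : ℝ) : ContinuousOn (radiusFun p M) (Set.Ico 0 1) := by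
  have hne : ∀ r ∈ Set.Ico (0 : ℝ) 1, 1 - r ≠ 0 := fun r hr => by linarith [hr.2]
  have h1 : ContinuousOn (fun r : ℝ => T M / (1 - r) ^ 2 *
      ∑ k ∈ Finset.Icc 2 p, (2 * (k : ℝ) - 1) * r ^ (2 * (k - 1))) (Set.Ico 0 1) :=
    (continuousOn_const.div (by fun_prop) fun r hr => pow_ne_zero _ (hne r hr)).mul
      (by fun_prop)
  have h2 : ContinuousOn (fun r : ℝ =>
      ∑ k ∈ Finset.Icc 1 p, 2 * T M * r ^ (2 * k - 1) / (1 - r) ^ 3) (Set.Ico 0 1) :=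
    continuousOn_finsetSum _ fun k _ =>
      ContinuousOn.div (by fun_prop) (by fun_prop) fun r hr => pow_ne_zero _ (hne r hr)
  exact ((continuousOn_const.sub h1).sub h2).sub (continuous_arctanTerm M).continuousOn

theorem radiusFun_zero (p : ℕ) (M : ℝ) : radiusFun p M 0 = lambda0 M := by
  have h1 : ∑ k ∈ Finset.Icc 2 p, (2 * (k : ℝ) - 1) * (0 : ℝ) ^ (2 * (k - 1)) = 0 :=
    Finset.sum_eq_zero fun k hk => by
      have := (Finset.mem_Icc.mp hk).1
      rw [zero_pow (by omega), mul_zero]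
  have h2 : ∑ k ∈ Finset.Icc 1 p, 2 * T M * (0 : ℝ) ^ (2 * k - 1) / (1 - 0) ^ 3 = 0 :=
    Finset.sum_eq_zero fun k hk => by
      have := (Finset.mem_Icc.mp hk).1
      rw [zero_pow (by omega), mul_zero, zero_div]
  rw [radiusFun_eq, h1, h2]
  simp [arctanTerm]

/-- Only the degree-one term of the third sum and the `arctan` term are kept. -/
theorem radiusFun_le {p : ℕ} (hp : 1 ≤ p) {M r : ℝ} (hM : 1 ≤ M) (hr : r ∈ Set.Ico (0 : ℝ) 1) :
    radiusFun p M r ≤ lambda0 M - T M * (2 * r / (1 - r) ^ 3) - arctanTerm M r := by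
  have hT := T_nonneg hM
  have hr0 := hr.1
  have hr1 : 0 < 1 - r := by linarith [hr.2]
  have h1 : 0 ≤ T M / (1 - r) ^ 2 *
      ∑ k ∈ Finset.Icc 2 p, (2 * (k : ℝ) - 1) * r ^ (2 * (k - 1)) := by
    refine mul_nonneg (by positivity) (Finset.sum_nonneg fun k hk => ?_)
    have := one_le_two_mul_sub_one hk
    positivity
  have h2 := Finset.single_le_sum (f := fun k => 2 * T M * r ^ (2 * k - 1) / (1 - r) ^ 3)
    (fun k _ => by positivity) (Finset.mem_Icc.mpr ⟨le_rfl, hp⟩)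
  have e : 2 * T M * r ^ (2 * 1 - 1) / (1 - r) ^ 3 = T M * (2 * r / (1 - r) ^ 3) := by
    norm_num
    ring
  simp only [e] at h2
  rw [radiusFun_eq]
  linarith

theorem radiusFun_one_fifth_neg {p : ℕ} (hp : 1 ≤ p) {M : ℝ} (hM : 1 ≤ M) :
    radiusFun p M (1 / 5) < 0 := by
  have h := radiusFun_le hp hM (r := 1 / 5) (by norm_num)
  have hT := T_nonneg hM
  have h1 := lambda0_le_one hM
  have h2 : 1 < arctanTerm M (1 / 5) := by
    have g1 := mul_le_arctan (x := 1 / 5) (by norm_num)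
    have g2 := four_le_s0
    have hpi := Real.pi_pos
    have g3 : (8 / 5 : ℝ) ≤ 16 * M / Real.pi ^ 2 := by
      rw [le_div_iff₀ (by positivity)]
      nlinarith [Real.pi_lt_d2]
    calc (1 : ℝ) < 8 / 5 * 4 * (25 / 26 * (1 / 5)) := by norm_num
      _ ≤ arctanTerm M (1 / 5) := by unfold arctanTerm; gcongr
  have h3 : 0 ≤ T M * (2 * (1 / 5) / (1 - 1 / 5) ^ 3) := by positivity
  linarith

theorem exists_radiusFun_eq_zero {p : ℕ} (hp : 1 ≤ p) {M : ℝ} (hM : 1 ≤ M) :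
    ∃ r ∈ Set.Ioo (0 : ℝ) (1 / 5), radiusFun p M r = 0 := by
  have hc : ContinuousOn (radiusFun p M) (Set.Icc 0 (1 / 5)) :=
    (radiusFun_continuousOn p M).mono fun x hx => ⟨hx.1, by linarith [hx.2]⟩
  exact intermediate_value_Ioo' (by norm_num) hc
    ⟨radiusFun_one_fifth_neg hp hM, by rw [radiusFun_zero]; exact lambda0_pos hM⟩

theorem coveredRadius_pos {p : ℕ} (hp : 1 ≤ p) {M r : ℝ} (hM : 1 < M)
    (hr : r ∈ Set.Ioo (0 : ℝ) 1) (h : radiusFun p M r = 0) : 0 < coveredRadius p M r := by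
  have hT := T_pos hM
  have hr0 := hr.1
  have hr1 : 0 < 1 - r := by linarith [hr.2]
  have h1 : ∑ k ∈ Finset.Icc 2 p, T M * r ^ (2 * (k - 1)) / (1 - r) ^ 2 ≤
      T M / (1 - r) ^ 2 * ∑ k ∈ Finset.Icc 2 p, (2 * (k : ℝ) - 1) * r ^ (2 * (k - 1)) := by
    rw [Finset.mul_sum]
    refine Finset.sum_le_sum fun k hk => ?_
    have h1 := one_le_two_mul_sub_one hk
    have h2 : 0 ≤ T M / (1 - r) ^ 2 * r ^ (2 * (k - 1)) := by positivity
    calc T M * r ^ (2 * (k - 1)) / (1 - r) ^ 2 = 1 * (T M / (1 - r) ^ 2 * r ^ (2 * (k - 1))) := by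
          ring
      _ ≤ (2 * (k : ℝ) - 1) * (T M / (1 - r) ^ 2 * r ^ (2 * (k - 1))) := by gcongr
      _ = _ := by ring
  have h2 : 0 < ∑ k ∈ Finset.Icc 1 p, 2 * T M * r ^ (2 * k - 1) / (1 - r) ^ 3 :=
    Finset.sum_pos (fun k _ => by positivity) ⟨1, Finset.mem_Icc.mpr ⟨le_rfl, hp⟩⟩
  rw [radiusFun_eq] at h
  refine mul_pos hr0 ?_
  change 0 < lambda0 M - ∑ k ∈ Finset.Icc 2 p, T M * r ^ (2 * (k - 1)) / (1 - r) ^ 2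
    - arctanTerm M r
  linarith

theorem coveredRadius_le (p : ℕ) {M r : ℝ} (hM : 1 ≤ M) (hr : r ∈ Set.Ioo (0 : ℝ) 1) :
    coveredRadius p M r ≤ r * (lambda0 M - arctanTerm M r) := by
  have hT := T_nonneg hM
  have hr0 := hr.1
  have hr1 : 0 < 1 - r := by linarith [hr.2]
  have h : 0 ≤ ∑ k ∈ Finset.Icc 2 p, T M * r ^ (2 * (k - 1)) / (1 - r) ^ 2 :=
    Finset.sum_nonneg fun k _ => by positivity
  unfold coveredRadius
  change r * (lambda0 M - _ - arctanTerm M r) ≤ _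
  gcongr
  linarith

/-! ### Splitting `opD f` into a linear map and a small remainder -/

/-- On `‖z‖ ≤ r ≤ 1 / 5` the map `opD f` is a linear map bounded below by `lambda0 M` plus a remainder
with controlled size and Lipschitz constant. The functions `G k` are indexed by the exponent
`2 (k - 1)` of `‖z‖`, so the normalized one is `G 1`. -/
theorem exists_opD_estimates {p : ℕ} (hp : 1 ≤ p) {M : ℝ} (hM : 1 ≤ M) {f : ℂ → ℂ}
    {G : ℕ → ℂ → ℂ}
    (hf : ∀ z ∈ ball (0 : ℂ) 1,
      f z = ∑ k ∈ Finset.Icc 1 p, ((‖z‖ ^ (2 * (k - 1)) : ℝ) : ℂ) * G k z)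
    (hG : ∀ k ∈ Finset.Icc 1 p, InnerProductSpace.HarmonicOnNhd (G k) (ball (0 : ℂ) 1))
    (hJ : jacobian f 0 = 1)
    (hGM : ∀ k ∈ Finset.Icc 1 p, ∀ z ∈ ball (0 : ℂ) 1, ‖G k z‖ ≤ M) :
    ∃ L : ℂ →ₗ[ℝ] ℂ, (∀ z, lambda0 M * ‖z‖ ≤ ‖L z‖) ∧ ∀ r ∈ Set.Icc (0 : ℝ) (1 / 5),
      (∀ z ∈ closedBall (0 : ℂ) r, ∀ w ∈ closedBall (0 : ℂ) r,
        ‖(opD f z - L z) - (opD f w - L w)‖ ≤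
          (T M * (2 * r / (1 - r) ^ 3) + arctanTerm M r) * ‖z - w‖) ∧
      ∀ z ∈ closedBall (0 : ℂ) r, ‖opD f z - L z‖ ≤ r * arctanTerm M r := by
  have hmem : 1 ∈ Finset.Icc 1 p := Finset.mem_Icc.mpr ⟨le_rfl, hp⟩
  have hsub : ∀ k ∈ Finset.Icc 2 p, k ∈ Finset.Icc 1 p := fun k hk => by
    rw [Finset.mem_Icc] at hk ⊢
    omega
  have hev : ∀ z ∈ ball (0 : ℂ) 1, f =ᶠ[nhds z] fun w => ∑ k ∈ Finset.Icc 1 p,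
      ((‖w‖ ^ (2 * (k - 1)) : ℝ) : ℂ) * G k w := fun z hz =>
    Set.EqOn.eventuallyEq_of_mem hf (isOpen_ball.mem_nhds hz)
  have hdiff : ∀ z ∈ ball (0 : ℂ) 1, ∀ k ∈ Finset.Icc 1 p, DifferentiableAt ℝ (G k) z :=
    fun z hz k hk => (hG k hk z hz).1.differentiableAt (by norm_num)
  have h0 : (0 : ℂ) ∈ ball (0 : ℂ) 1 := by simp
  have hopD : ∀ z ∈ ball (0 : ℂ) 1, opD f z = opD (G 1) z +
      ∑ k ∈ Finset.Icc 2 p, ((‖z‖ ^ (2 * (k - 1)) : ℝ) : ℂ) * opD (G k) z := fun z hz => by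
    rw [opD_pHarmonic (hev z hz) (hdiff z hz), ← Finset.insert_Icc_add_one_left_eq_Icc hp,
      Finset.sum_insert (by simp)]
    simp
  have hcoeff : ∀ k ∈ Finset.Icc 1 p, ∃ a b : ℕ → ℂ, IsHarmonicCoeff (G k) a b :=
    fun k hk => exists_isHarmonicCoeff (hG k hk)
  obtain ⟨a, b, hab⟩ := hcoeff 1 hmem
  -- The normalization `J_f(0) = 1` only involves the coefficients of degree one of `G 1`.
  have hfd := fderiv_pHarmonic_zero hp (hev 0 h0) (hdiff 0 h0)
  have hJ' : ‖a 1‖ ^ 2 - ‖b 1‖ ^ 2 = 1 := by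
    have h1 : wirtinger f 0 = a 1 := by rw [← hab.wirtinger_zero, wirtinger, wirtinger, hfd]
    have h2 : wirtingerBar f 0 = conj (b 1) := by
      rw [← hab.wirtingerBar_zero, wirtingerBar, wirtingerBar, hfd]
    rwa [jacobian, h1, h2, RCLike.norm_conj] at hJ
  have hb2 := sq_nonneg ‖b 1‖
  have hsq := fun n : ℕ => hab.norm_sq_add_le (hGM 1 hmem) (n := n + 2) (by omega)
  have hA := fun n : ℕ => hab.norm_add_norm_le (hGM 1 hmem) (n := n + 1) (by omega)
  have hlam : lambda0 M ≤ ‖a 1‖ - ‖b 1‖ := by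
    refine lambda0_le_sub hM (norm_nonneg _) (norm_nonneg _) hJ' (hA 0) ?_
    have h1 := hsq 0
    have h2 : 0 ≤ ‖a (0 + 2)‖ ^ 2 + ‖b (0 + 2)‖ ^ 2 := by positivity
    linarith
  have hT : ∀ n : ℕ, ‖a (n + 2)‖ + ‖b (n + 2)‖ ≤ T M := fun n =>
    add_le_T (hA (n + 1)) (by linarith [hsq n])
  refine ⟨linearPart (a 1) (b 1), fun z => le_trans (by gcongr)
    (norm_sub_norm_mul_le_norm_linearPart (a 1) (b 1) z), fun r hr => ?_⟩
  have hr1 : r ∈ Set.Ico (0 : ℝ) 1 := ⟨hr.1, by linarith [hr.2]⟩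
  have hrem := remainder_le_arctanTerm hM p hp hr
  have hball : ∀ z ∈ closedBall (0 : ℂ) r, z ∈ ball (0 : ℂ) 1 := fun z hz =>
    closedBall_subset_ball hr1.2 hz
  have hk : ∀ k ∈ Finset.Icc 2 p, ∀ z ∈ closedBall (0 : ℂ) r, ∀ w ∈ closedBall (0 : ℂ) r,
      ‖((‖z‖ ^ (2 * (k - 1)) : ℝ) : ℂ) * opD (G k) z -
        ((‖w‖ ^ (2 * (k - 1)) : ℝ) : ℂ) * opD (G k) w‖ ≤ 4 * M / Real.pi *
      (r ^ (2 * (k - 1)) * ((2 * ((k - 1 : ℕ) : ℝ) + 1) / (1 - r) ^ 2 + 2 * r / (1 - r) ^ 3)) *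
        ‖z - w‖ := by
    intro k hk z hz w hw
    obtain ⟨a', b', hab'⟩ := hcoeff k (hsub k hk)
    exact hab'.norm_opD_sub_le
      (fun n => hab'.norm_add_norm_le (hGM k (hsub k hk)) (by omega)) hr1
      (mem_closedBall_zero_iff.mp hz) (mem_closedBall_zero_iff.mp hw) (k - 1)
  have hsum : ∀ z ∈ closedBall (0 : ℂ) r, ∀ w ∈ closedBall (0 : ℂ) r,
      ‖∑ k ∈ Finset.Icc 2 p, ((‖z‖ ^ (2 * (k - 1)) : ℝ) : ℂ) * opD (G k) z -
        ∑ k ∈ Finset.Icc 2 p, ((‖w‖ ^ (2 * (k - 1)) : ℝ) : ℂ) * opD (G k) w‖ ≤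
      (arctanTerm M r - 4 * M / Real.pi * (1 / (1 - r) ^ 2 - 1)) * ‖z - w‖ := by
    intro z hz w hw
    rw [← Finset.sum_sub_distrib]
    refine (norm_sum_le_of_le _ fun k hk' => hk k hk' z hz w hw).trans ?_
    rw [← Finset.sum_mul]
    gcongr
    linarith
  constructor
  · intro z hz w hw
    have h1 := hab.norm_opD_sub_linearPart_sub_le (fun n => hA (n + 1)) hT hr1
      (mem_closedBall_zero_iff.mp hz) (mem_closedBall_zero_iff.mp hw)
    have h2 := hsum z hz w hw
    rw [hopD z (hball z hz), hopD w (hball w hw)]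
    refine le_trans (le_of_eq (congrArg norm ?_)) ((norm_add_le_of_le h1 h2).trans_eq ?_)
    · ring
    · ring
  · intro z hz
    have h1 := hab.norm_opD_sub_linearPart_le (fun n => hA (n + 1)) hr1
      (mem_closedBall_zero_iff.mp hz)
    -- The terms with `k ≥ 2` vanish at the origin, so their size follows from their variation.
    have h2 := hsum z hz 0 (mem_closedBall_self hr.1)
    have hz0 : ∑ k ∈ Finset.Icc 2 p, ((‖(0 : ℂ)‖ ^ (2 * (k - 1)) : ℝ) : ℂ) * opD (G k) 0 = 0 :=
      Finset.sum_eq_zero fun k _ => by simp [opD]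
    have hnn : 0 ≤ arctanTerm M r - 4 * M / Real.pi * (1 / (1 - r) ^ 2 - 1) := by
      refine le_trans ?_ (le_sub_iff_add_le'.mpr hrem)
      have := Real.pi_pos
      have := hr.1
      have : 0 ≤ 1 - r := by linarith [hr.2]
      exact Finset.sum_nonneg fun k _ => by positivity
    rw [hz0, sub_zero, sub_zero] at h2
    rw [hopD z (hball z hz), add_sub_right_comm]
    have h3 := mul_le_mul_of_nonneg_left (mem_closedBall_zero_iff.mp hz) hnn
    refine (norm_add_le_of_le h1 (h2.trans h3)).trans_eq ?_
    ring

end PHarmonicLandau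

end

open PHarmonicLandau Metric

theorem mainTheorem1 (p : ℕ) (hp : 1 ≤ p) (M : ℝ) (hM : 1 ≤ M) :
    ∃ ρ : ℝ, ρ ∈ Set.Ioo (0 : ℝ) 1 ∧ PHarmonicLandau.radiusFun p M ρ = 0 ∧
      (∀ ρ' ∈ Set.Ioo (0 : ℝ) 1, PHarmonicLandau.radiusFun p M ρ' = 0 → ρ' = ρ) ∧
      (1 < M → 0 < PHarmonicLandau.coveredRadius p M ρ) ∧
      ∀ (f : ℂ → ℂ) (G : ℕ → ℂ → ℂ),
        (∀ z ∈ Metric.ball (0 : ℂ) 1,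
          f z = ∑ k ∈ Finset.Icc 1 p, ((‖z‖ ^ (2 * (k - 1)) : ℝ) : ℂ) * G (p - k + 1) z) →
        (∀ k ∈ Finset.Icc 1 p,
          InnerProductSpace.HarmonicOnNhd (G (p - k + 1)) (Metric.ball (0 : ℂ) 1)) →
        f 0 = 0 → G p 0 = 0 →
        PHarmonicLandau.jacobian f 0 = 1 →
        (∀ k ∈ Finset.Icc 1 p, ∀ z ∈ Metric.ball (0 : ℂ) 1, ‖G (p - k + 1) z‖ ≤ M) →
        Set.InjOn (PHarmonicLandau.opD f) (Metric.ball (0 : ℂ) ρ) ∧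
        Metric.ball (0 : ℂ) (PHarmonicLandau.coveredRadius p M ρ) ⊆
          PHarmonicLandau.opD f '' Metric.ball (0 : ℂ) ρ := by
  obtain ⟨ρ, hρ, hroot⟩ := exists_radiusFun_eq_zero hp hM
  have hρ1 : ρ ∈ Set.Ioo (0 : ℝ) 1 := ⟨hρ.1, by linarith [hρ.2]⟩
  have hanti := radiusFun_strictAntiOn p hM
  refine ⟨ρ, hρ1, hroot, fun ρ' hρ' h => ?_, fun hM1 => coveredRadius_pos hp hM1 hρ1 hroot, ?_⟩
  · exact hanti.injOn (Set.Ioo_subset_Ico_self hρ') (Set.Ioo_subset_Ico_self hρ1)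
      (h.trans hroot.symm)
  intro f G hf hG _ _ hJ hGM
  obtain ⟨L, hL, hest⟩ := exists_opD_estimates hp hM (G := fun k => G (p - k + 1)) hf hG hJ hGM
  have hT := T_nonneg hM
  have hlip : ∀ r ∈ Set.Ico 0 ρ, T M * (2 * r / (1 - r) ^ 3) + arctanTerm M r < lambda0 M := by
    intro r hr
    have hr1 : r ∈ Set.Ico (0 : ℝ) 1 := ⟨hr.1, hr.2.trans hρ1.2⟩
    have h1 := hanti hr1 (Set.Ioo_subset_Ico_self hρ1) hr.2
    have h2 := radiusFun_le hp hM hr1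
    linarith
  constructor
  · intro z hz w hw hzw
    rw [mem_ball_zero_iff] at hz hw
    have hr : max ‖z‖ ‖w‖ ∈ Set.Ico 0 ρ := ⟨le_max_of_le_left (norm_nonneg z), max_lt hz hw⟩
    have h1 := (hest _ ⟨hr.1, hr.2.le.trans hρ.2.le⟩).1 z
      (mem_closedBall_zero_iff.mpr (le_max_left _ _)) w
      (mem_closedBall_zero_iff.mpr (le_max_right _ _))
    have h2 := hL (z - w)
    rw [hzw, sub_sub_sub_cancel_left, ← map_sub, ← norm_neg, ← map_neg, neg_sub] at h1
    by_contra hne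
    have h3 := mul_lt_mul_of_pos_right (hlip _ hr) (norm_pos_iff.mpr (sub_ne_zero.mpr hne))
    linarith
  · intro w hw
    rw [mem_ball_zero_iff] at hw
    have hw' := hw.trans_le (coveredRadius_le p hM hρ1)
    -- By continuity the covering condition already holds on a disk of radius `r < ρ`.
    have hcont : Filter.Tendsto (fun r => r * (lambda0 M - arctanTerm M r))
        (nhdsWithin ρ (Set.Iio ρ)) (nhds (ρ * (lambda0 M - arctanTerm M ρ))) :=
      ((continuous_id.mul (continuous_const.sub (continuous_arctanTerm M))).tendsto ρ).mono_left
        nhdsWithin_le_nhds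
    obtain ⟨r, hrw, hr⟩ := ((hcont.eventually (lt_mem_nhds hw')).and
      (Ico_mem_nhdsLT hρ.1)).exists
    obtain ⟨h1, h2⟩ := hest r ⟨hr.1, hr.2.le.trans hρ.2.le⟩
    have hK : 0 ≤ T M * (2 * r / (1 - r) ^ 3) + arctanTerm M r := by
      have := arctanTerm_nonneg hM hr.1
      have := hr.1
      have : 0 ≤ 1 - r := by linarith [hr.2, hρ.2]
      positivity
    obtain ⟨z, hz, hzw⟩ := exists_mem_closedBall_eq hr.1 hL hK (hlip r hr) h1 h2
      (w := w) (by linarith)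
    exact ⟨z, closedBall_subset_ball hr.2 hz, hzw⟩
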